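/- Let $K$ be a field, $q\in K^\times$, $A$ an associative unital $K$-algebra and $m,n\ge 0$. Put $\bar i=0$ for $1\le i\le m$, $\bar i=1$ for $m<i\le m+n$, and let $\varepsilon(a)\in\{1,0,-1\}$ be the sign of the integer $a$. An $(m+n)\times(m+n)$ matrix $M=(M_{ij})$ over $A$ is called a $q$-super Manin matrix if for all indices $i,j,k,l$ $$M_{ij}^2=0\quad\text{if } \bar i=1,\ \bar j=0,$$ $$M_{ik}M_{il}=q^{\varepsilon(l-k)}(-1)^{(\bar k+1)(\bar l+1)}M_{il}M_{ik}\quad\text{if }\bar i=1,$$ $$M_{ik}M_{jk}=q^{\varepsilon(i-j)}(-1)^{\bar i\bar j}M_{jk}M_{ik}\quad\text{if }\bar k=0,$$ $$M_{ij}M_{kl}-q^{\varepsilon(i-k)+\varepsilon(l-j)}(-1)^{(\bar i+\bar j)(\bar k+\bar l)}M_{kl}M_{ij}=q^{\varepsilon(i-k)}(-1)^{\bar i\bar k+\bar j\bar k+\bar i\bar j}M_{kj}M_{il}-q^{\varepsilon(l-j)}(-1)^{\bar j\bar k+\bar j\bar l+\bar k\bar l}M_{il}M_{kj}.$$ Let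 $l(\sigma)$ denote the number of inversions of a permutation $\sigma$. Let $M$ be a $q$-super Manin matrix with a two-sided inverse $M^{-1}$ that is a $q^{-1}$-super Manin matrix, and write $M=\begin{pmatrix}M_{11}&M_{12}\\M_{21}&M_{22}\end{pmatrix}$ with $M_{11}$ of size $m\times m$ and $M_{22}$ of size $n\times n$. The quantum Berezinian of $M$ is $$\mathrm{Ber}_q(M)=\sum_{\sigma\in\mathfrak S_m}(-q)^{-l(\sigma)}M_{\sigma(1),1}\cdots M_{\sigma(m),m}\cdot\sum_{\rho\in\mathfrak S_n}(-q)^{-l(\rho)}(M^{-1})_{m+1,m+\rho(1)}\cdots(M^{-1})_{m+n,m+\rho(n)}.$$ For an $m\times m$ even block $X$ and an $n\times n$ odd block $Y$ put $$\textstyle\det_q(X)=\sum_{\sigma\in\mathfrak S_m}(-q)^{-l(\sigma)}X_{\sigma(1),1}\cdots X_{\sigma(m),m},\qquad \det_{q^{-1}}(Y)=\sum_{\rho\in\mathfrak S_n}(-q)^{l(\rho)}Y_{1,\rho(1)}\cdots Y_{n,\rho(n)}.$$ Suppose that $M_{11}$ has a two-sided inverse. If $\det_q(M_{11})$ is invertible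 in $A$, then so is $\det_{q^{-1}}(M_{22}-M_{21}M_{11}^{-1}M_{12})$. Moreover, whenever $\det_{q^{-1}}(M_{22}-M_{21}M_{11}^{-1}M_{12})$ is invertible, $$\mathrm{Ber}_q(M)=\textstyle\det_q(M_{11})\,\det_{q^{-1}}\!\left(M_{22}-M_{21}M_{11}^{-1}M_{12}\right)^{-1}.$$ -/

import Mathlib

namespace QuantumSuper

/-- The index set `[m+n]`, written as the disjoint union of the `m` even indices `1, …, m`
and the `n` odd indices `m+1, …, m+n`. -/
abbrev Idx (m n : ℕ) : Type := Fin m ⊕ Fin n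

/-- The parity of an index: `0` for the first `m` indices, `1` for the last `n`. -/
def parity {m n : ℕ} : Idx m n → ℕ :=
  Sum.elim (fun _ => 0) (fun _ => 1)

/-- The position of an index in the linear order `1 < ⋯ < m < m+1 < ⋯ < m+n`
(counted from `0`). -/
def position {m n : ℕ} : Idx m n → ℤ :=
  Sum.elim (fun i => ((i : ℕ) : ℤ)) (fun j => (m : ℤ) + ((j : ℕ) : ℤ))

/-- The symbol `ε(i - j) ∈ {1, 0, -1}`: `1` if `i > j`, `0` if `i = j`, `-1` if `i < j`. -/
def eps {m n : ℕ} (i j : Idx m n) : ℤ :=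
  Int.sign (position i - position j)

/-- An `(m+n) × (m+n)` matrix over a `K`-algebra is a `q`-super Manin matrix if its entries
satisfy the defining relations of the generators of the right quantum superalgebra of
`K^{m|n}`. -/
structure IsSuperManin {K A : Type*} [Field K] [Ring A] [Algebra K A] {m n : ℕ} (q : K)
    (M : Matrix (Idx m n) (Idx m n) A) : Prop where
  sq_zero : ∀ i j : Idx m n, parity i = 1 → parity j = 0 → M i j * M i j = 0
  row : ∀ i k l : Idx m n, parity i = 1 →
    M i k * M i l
      - (q ^ eps l k * (-1) ^ ((parity k + 1) * (parity l + 1))) • (M i l * M i k) = 0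
  col : ∀ i j k : Idx m n, parity k = 0 →
    M i k * M j k
      - (q ^ eps i j * (-1) ^ (parity i * parity j)) • (M j k * M i k) = 0
  cross : ∀ i j k l : Idx m n,
    M i j * M k l
      - (q ^ (eps i k + eps l j)
          * (-1) ^ ((parity i + parity j) * (parity k + parity l))) • (M k l * M i j)
    = (q ^ eps i k
          * (-1) ^ (parity i * parity k + parity j * parity k + parity i * parity j))
        • (M k j * M i l)
      - (q ^ eps l j
          * (-1) ^ (parity j * parity k + parity j * parity l + parity k * parity l))
        • (M i l * M k j)

/-- The length `l(σ)` of a permutation: its number of inversions. -/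
def permLength {r : ℕ} (σ : Equiv.Perm (Fin r)) : ℕ :=
  (Finset.univ.filter fun p : Fin r × Fin r => p.1 < p.2 ∧ σ p.2 < σ p.1).card

/-- The quantum determinant of an even block, expanded along columns:
`∑_σ (-q)^{-l(σ)} X_{σ(1),1} ⋯ X_{σ(r),r}`, the factors being multiplied in this order. -/
def evenDet {K A : Type*} [Field K] [Ring A] [Algebra K A] {r : ℕ} (q : K)
    (X : Matrix (Fin r) (Fin r) A) : A :=
  ∑ σ : Equiv.Perm (Fin r),
    ((-q)⁻¹ ^ permLength σ) • (List.ofFn fun i : Fin r => X (σ i) i).prod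

/-- The quantum determinant of an odd block, expanded along rows:
`∑_ρ (-q)^{-l(ρ)} X_{1,ρ(1)} ⋯ X_{r,ρ(r)}`, the factors being multiplied in this order. -/
def oddDet {K A : Type*} [Field K] [Ring A] [Algebra K A] {r : ℕ} (q : K)
    (X : Matrix (Fin r) (Fin r) A) : A :=
  ∑ ρ : Equiv.Perm (Fin r),
    ((-q)⁻¹ ^ permLength ρ) • (List.ofFn fun i : Fin r => X i (ρ i)).prod

/-- The quantum Berezinian of an invertible matrix `M`:
`∑_{σ ∈ S_m} (-q)^{-l(σ)} M_{σ(1),1} ⋯ M_{σ(m),m}`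
`  × ∑_{ρ ∈ S_n} (-q)^{-l(ρ)} (M⁻¹)_{m+1,m+ρ(1)} ⋯ (M⁻¹)_{m+n,m+ρ(n)}`. -/
def ber {K A : Type*} [Field K] [Ring A] [Algebra K A] {m n : ℕ} (q : K)
    (M : (Matrix (Idx m n) (Idx m n) A)ˣ) : A :=
  evenDet q (M : Matrix (Idx m n) (Idx m n) A).toBlocks₁₁ *
    oddDet q ((M⁻¹ : (Matrix (Idx m n) (Idx m n) A)ˣ) : Matrix (Idx m n) (Idx m n) A).toBlocks₂₂

/-- The Schur complement `M₂₂ - M₂₁ M₁₁⁻¹ M₁₂`, for an invertible upper left block given as a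
unit `M₁₁` of the matrix ring. -/
def schurCompl {A : Type*} [Ring A] {m n : ℕ} (M : Matrix (Idx m n) (Idx m n) A)
    (M₁₁ : (Matrix (Fin m) (Fin m) A)ˣ) : Matrix (Fin n) (Fin n) A :=
  M.toBlocks₂₂
    - M.toBlocks₂₁ * ((M₁₁⁻¹ : (Matrix (Fin m) (Fin m) A)ˣ) : Matrix (Fin m) (Fin m) A)
      * M.toBlocks₁₂

end QuantumSuper

/-!
Write `Z = M₁₁⁻¹ M₁₂`, let `S` be the Schur complement and `Y` the lower right block of `M⁻¹`, so
that `S Y = Y S = 1` (`schurCompl_mul_inv`). By definition the Berezinian is `det_q M₁₁ * det_q Y`,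
so the theorem compares `det_q Y` with `det_{q⁻¹} S`.

Odd quantum determinants are coefficients of top words in quantum Grassmann variables `ψ` that
commute with `A`: if the elements `ψ' i = ∑ j, Y i j ψ j` satisfy the relations of the `ψ i`, then
`ψ' 1 ⋯ ψ' n = det_q Y * ψ 1 ⋯ ψ n`. Since `ψ = S ψ'` and the `ψ i` commute with the entries of `S`,
the reversed word `ψ n ⋯ ψ 1` expands into words in `ψ'` with coefficients
`S 1 (v 1) ⋯ S n (v n)`. This yields `det_{q⁻¹} S * det_q Y = 1` without any relation between the
entries of `S` (`oddDet_inv_mul_oddDet`). The relations of `M⁻¹` provide the hypothesis on `Y`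
(`IsSuperManin.isGrassmann_odd`), and the formula for the Berezinian follows.

For invertibility one exchanges the roles of `S` and `Y`, which needs the elements
`∑ j, S i j η j` to satisfy Grassmann relations. A super Manin matrix preserves the quadratic
relations of the quantum symmetric superalgebra in even variables `y` and odd variables `η`
(`IsSuperManin.isSuperQuad_rowForm`). Eliminating the even variables by `y = -Z η` turns the odd
rows of `M` into the rows of `S` (`IsSuperManin.isGrassmann_schur`), provided that the elements
`Z η` satisfy the commutation relations of the `y`. The latter follow from the relations of
`M₁₁` and `M₁₂` after multiplication by `det_q M₁₁` on the left
(`IsSuperManin.even_inv_mul_relation`), and this is where the invertibility of `det_q M₁₁` enters.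
-/

namespace QuantumSuper

/-! ### Words in `q`-Grassmann variables -/

/-- A finite family of elements of a `K`-algebra satisfying the relations of the generators of a
quantum Grassmann algebra: `ψ i ^ 2 = 0` and `ψ j * ψ i = κ ψ i * ψ j` for `i < j`. -/
structure IsGrassmann {K R : Type*} [Field K] [Ring R] [Algebra K R] {n : ℕ} (κ : K)
    (ψ : Fin n → R) : Prop where
  sq : ∀ i, ψ i * ψ i = 0
  swap : ∀ i j, i < j → ψ j * ψ i = κ • (ψ i * ψ j)

/-- The number of inversions of a word. -/
def wordInv {n : ℕ} : List (Fin n) → ℕ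
  | [] => 0
  | a :: L => L.countP (· < a) + wordInv L

theorem wordInv_ofFn {n r : ℕ} (v : Fin r → Fin n) :
    wordInv (List.ofFn v) =
      (Finset.univ.filter fun p : Fin r × Fin r => p.1 < p.2 ∧ v p.2 < v p.1).card := by
  rw [Finset.card_filter, Fintype.sum_prod_type]
  induction r with
  | zero => simp [wordInv]
  | succ r ih =>
    rw [List.ofFn_succ, wordInv, ih, Fin.sum_univ_succ]
    congr 1
    · rw [Fin.sum_univ_succ]
      simp only [lt_self_iff_false, false_and, if_false, zero_add, Fin.succ_pos, true_and]
      rw [← Finset.card_filter, List.ofFn_eq_map, List.countP_map, Fin.univ_def]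
      rw [List.countP_eq_length_filter]
      rfl
    · refine Finset.sum_congr rfl fun i _ => ?_
      rw [Fin.sum_univ_succ]
      simp

section Words

variable {K R : Type*} [Field K] [Ring R] [Algebra K R] {n : ℕ} {κ : K} {ψ : Fin n → R}

theorem IsGrassmann.mul_prod_of_mem (h : IsGrassmann κ ψ) (hκ : κ ≠ 0) (a : Fin n)
    (L : List (Fin n)) (ha : a ∈ L) : ψ a * (L.map ψ).prod = 0 := by
  induction L with
  | nil => simp at ha
  | cons b L ih =>
    rw [List.map_cons, List.prod_cons, ← mul_assoc]
    rcases lt_trichotomy a b with hab | rfl | hab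
    · have hm : a ∈ L := by simpa [hab.ne] using ha
      have : ψ a * ψ b = κ⁻¹ • (ψ b * ψ a) := by
        rw [h.swap a b hab, smul_smul, inv_mul_cancel₀ hκ, one_smul]
      rw [this, smul_mul_assoc, mul_assoc, ih hm, mul_zero, smul_zero]
    · rw [h.sq, zero_mul]
    · have hm : a ∈ L := by simpa [hab.ne'] using ha
      rw [h.swap b a hab, smul_mul_assoc, mul_assoc, ih hm, mul_zero, smul_zero]

theorem IsGrassmann.prod_eq_zero (h : IsGrassmann κ ψ) (hκ : κ ≠ 0)
    (L : List (Fin n)) (hL : ¬ L.Nodup) : (L.map ψ).prod = 0 := by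
  induction L with
  | nil => simp at hL
  | cons b L ih =>
    rw [List.map_cons, List.prod_cons]
    by_cases hb : b ∈ L
    · exact h.mul_prod_of_mem hκ b L hb
    · rw [ih (fun hn => hL (List.nodup_cons.2 ⟨hb, hn⟩)), mul_zero]

theorem IsGrassmann.prod_orderedInsert (h : IsGrassmann κ ψ) (a : Fin n)
    (L : List (Fin n)) (hs : L.Pairwise (· ≤ ·)) (ha : a ∉ L) :
    ψ a * (L.map ψ).prod =
      κ ^ L.countP (· < a) • ((L.orderedInsert (· ≤ ·) a).map ψ).prod := by
  induction L with
  | nil => simp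
  | cons b L ih =>
    rw [List.pairwise_cons] at hs
    by_cases hab : a ≤ b
    · have h0 : (b :: L).countP (· < a) = 0 := by
        rw [List.countP_eq_zero]
        intro c hc
        rcases List.mem_cons.1 hc with rfl | hc
        · simpa using hab
        · simpa using hab.trans (hs.1 c hc)
      rw [h0, List.orderedInsert_cons, if_pos hab]
      simp
    · rw [List.orderedInsert_cons, if_neg hab, List.map_cons, List.prod_cons, ← mul_assoc,
        h.swap b a (not_le.1 hab), smul_mul_assoc, mul_assoc,
        ih hs.2 (fun hc => ha (List.mem_cons_of_mem _ hc)),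
        List.countP_cons_of_pos (by simpa using hab), mul_smul_comm, smul_smul, pow_succ',
        List.map_cons, List.prod_cons]

theorem IsGrassmann.prod_insertionSort (h : IsGrassmann κ ψ) (L : List (Fin n)) (hL : L.Nodup) :
    (L.map ψ).prod = κ ^ wordInv L • ((L.insertionSort (· ≤ ·)).map ψ).prod := by
  induction L with
  | nil => simp [wordInv]
  | cons a L ih =>
    rw [List.nodup_cons] at hL
    have hp := List.perm_insertionSort (· ≤ ·) L
    rw [List.map_cons, List.prod_cons, ih hL.2, mul_smul_comm,
      h.prod_orderedInsert a _ (List.pairwise_insertionSort _ _) (fun hc => hL.1 (hp.mem_iff.1 hc)),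
      smul_smul, List.insertionSort_cons, wordInv, hp.countP_eq, pow_add, mul_comm]

/-- A word in which every variable occurs exactly once equals the ordered word up to `κ` to the
number of inversions. -/
theorem IsGrassmann.prod_of_perm (h : IsGrassmann κ ψ) (L : List (Fin n))
    (hL : L.Perm (List.finRange n)) :
    (L.map ψ).prod = κ ^ wordInv L • ((List.finRange n).map ψ).prod := by
  have hn : L.Nodup := hL.nodup_iff.2 (List.nodup_finRange n)
  rw [h.prod_insertionSort L hn]
  have : L.insertionSort (· ≤ ·) = List.finRange n := by
    refine List.Perm.eq_of_pairwise (le := (· ≤ ·)) (fun a b _ _ hab hba => le_antisymm hab hba)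
      (List.pairwise_insertionSort _ _) ?_ ((List.perm_insertionSort _ _).trans hL)
    exact (List.pairwise_lt_finRange n).imp le_of_lt
  rw [this]

theorem perm_finRange_of_injective (v : Fin n → Fin n) (hv : Function.Injective v) :
    (List.ofFn v).Perm (List.finRange n) := by
  refine (List.perm_ext_iff_of_nodup (List.nodup_ofFn.2 hv) (List.nodup_finRange n)).2 fun a => ?_
  simpa [List.mem_ofFn] using (Finite.surjective_of_injective hv) a

theorem sum_maps_eq_sum_perm (F W : (Fin n → Fin n) → R) (c : Equiv.Perm (Fin n) → K) (T : R)
    (h0 : ∀ v, ¬ (List.ofFn v).Nodup → W v = 0) (hσ : ∀ σ : Equiv.Perm (Fin n), W σ = c σ • T) :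
    ∑ v : Fin n → Fin n, F v * W v = (∑ σ : Equiv.Perm (Fin n), c σ • F σ) * T := by
  rw [Finset.sum_mul]
  symm
  refine Finset.sum_of_injOn (fun σ : Equiv.Perm (Fin n) => (σ : Fin n → Fin n))
    (fun σ _ τ _ hστ => DFunLike.coe_injective hστ)
    (fun _ _ => Finset.mem_coe.2 (Finset.mem_univ _))
    ?_ ?_
  · intro v _ hv
    rw [h0, mul_zero]
    intro hn
    rw [List.nodup_ofFn] at hn
    exact hv ⟨Equiv.ofBijective v (Finite.injective_iff_bijective.1 hn), by simp, rfl⟩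
  · intro σ _
    rw [hσ, mul_smul_comm, smul_mul_assoc]

/-- A sum over maps `Fin n → Fin n` of terms carrying a word in Grassmann variables is a sum over
permutations, each contributing `κ` to its length. -/
theorem IsGrassmann.sum_words (h : IsGrassmann κ ψ) (hκ : κ ≠ 0)
    (F : (Fin n → Fin n) → R) :
    ∑ v : Fin n → Fin n, F v * ((List.ofFn v).map ψ).prod =
      (∑ σ : Equiv.Perm (Fin n), κ ^ permLength σ • F σ) * ((List.finRange n).map ψ).prod := by
  refine sum_maps_eq_sum_perm F _ _ _ (fun v hv => h.prod_eq_zero hκ _ hv) fun σ => ?_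
  rw [h.prod_of_perm _ (perm_finRange_of_injective _ σ.injective), wordInv_ofFn, permLength]

theorem IsGrassmann.op (h : IsGrassmann κ ψ) (hκ : κ ≠ 0) :
    IsGrassmann κ⁻¹ (fun i => MulOpposite.op (ψ i)) where
  sq i := by rw [← MulOpposite.op_mul, h.sq, MulOpposite.op_zero]
  swap i j hij := by
    rw [← MulOpposite.op_mul, ← MulOpposite.op_mul, ← MulOpposite.op_smul, h.swap i j hij,
      smul_smul, inv_mul_cancel₀ hκ, one_smul]

theorem op_prod_map (L : List (Fin n)) :
    (L.map fun i => MulOpposite.op (ψ i)).prod = MulOpposite.op ((L.map ψ).reverse.prod) := by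
  rw [MulOpposite.op_list_prod, List.map_reverse, List.reverse_reverse, List.map_map]
  rfl

/-- The analogue of `IsGrassmann.sum_words` for words read from right to left: inversions now
contribute `κ⁻¹`, as one sees in the opposite ring. -/
theorem IsGrassmann.sum_words_reverse (h : IsGrassmann κ ψ) (hκ : κ ≠ 0)
    (F : (Fin n → Fin n) → R) :
    ∑ v : Fin n → Fin n, F v * ((List.ofFn v).map ψ).reverse.prod =
      (∑ σ : Equiv.Perm (Fin n), κ⁻¹ ^ permLength σ • F σ) *
        ((List.finRange n).map ψ).reverse.prod := by
  refine sum_maps_eq_sum_perm F _ _ _ (fun v hv => ?_) fun σ => ?_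
  · apply MulOpposite.op_injective
    rw [← op_prod_map, (h.op hκ).prod_eq_zero (inv_ne_zero hκ) _ hv, MulOpposite.op_zero]
  · apply MulOpposite.op_injective
    rw [MulOpposite.op_smul, ← op_prod_map, ← op_prod_map,
      (h.op hκ).prod_of_perm _ (perm_finRange_of_injective _ σ.injective), wordInv_ofFn, permLength]

end Words

/-! ### Quantum determinants as coefficients of top words -/

theorem prod_ofFn_sum {R : Type*} [Ring R] {n r : ℕ} (a : Fin r → Fin n → R) (y : Fin n → R)
    (hc : ∀ i j k, Commute (a i j) (y k)) :
    (List.ofFn fun i => ∑ j, a i j * y j).prod =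
      ∑ v : Fin r → Fin n, (List.ofFn fun i => a i (v i)).prod * ((List.ofFn v).map y).prod := by
  induction r with
  | zero => simp
  | succ r ih =>
    rw [List.ofFn_succ, List.prod_cons, ih _ (fun i => hc i.succ),
      ← (Fin.consEquiv fun _ => Fin n).sum_comp, Fintype.sum_prod_type, Finset.sum_mul_sum]
    refine Finset.sum_congr rfl fun j _ => Finset.sum_congr rfl fun v _ => ?_
    have hy : Commute (y j) (List.ofFn fun i : Fin r => a i.succ (v i)).prod := by
      refine Commute.list_prod_right _ _ fun x hx => ?_
      obtain ⟨i, rfl⟩ := List.mem_ofFn.1 hx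
      exact (hc _ _ _).symm
    simp only [Fin.consEquiv_apply, List.ofFn_succ, Fin.cons_zero, Fin.cons_succ, List.prod_cons,
      List.map_cons]
    rw [mul_assoc, ← mul_assoc (y j), hy.eq]
    simp only [mul_assoc]

/-- If `x i = ∑ j, a i j * y j` and the coefficients commute with the `x k` (not necessarily
with the `y k`), then `x (r-1) * ⋯ * x 0` expands with the coefficients in the order
`a 0 * ⋯ * a (r-1)`. -/
theorem prod_reverse_eq_sum {R : Type*} [Ring R] {n r : ℕ} (a : Fin r → Fin n → R)
    (x : Fin r → R) (y : Fin n → R) (hx : ∀ i, x i = ∑ j, a i j * y j)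
    (hc : ∀ i j k, Commute (a i j) (x k)) :
    (List.ofFn x).reverse.prod =
      ∑ v : Fin r → Fin n,
        (List.ofFn fun i => a i (v i)).prod * ((List.ofFn v).map y).reverse.prod := by
  induction r with
  | zero => simp
  | succ r ih =>
    have hy : ∀ j, Commute (a 0 j) (List.ofFn fun i : Fin r => x i.succ).reverse.prod := by
      intro j
      refine Commute.list_prod_right _ _ fun z hz => ?_
      obtain ⟨i, rfl⟩ := List.mem_ofFn.1 (List.mem_reverse.1 hz)
      exact hc _ _ _
    rw [List.ofFn_succ, List.reverse_cons, List.prod_append, List.prod_singleton, hx 0,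
      Finset.mul_sum, ← (Fin.consEquiv fun _ => Fin n).sum_comp, Fintype.sum_prod_type]
    refine Finset.sum_congr rfl fun j _ => ?_
    rw [← mul_assoc, ← (hy j).eq,
      ih (fun i => a i.succ) (fun i => x i.succ) (fun i => hx i.succ) (fun i j k => hc _ _ _),
      Finset.mul_sum, Finset.sum_mul]
    refine Finset.sum_congr rfl fun v _ => ?_
    simp only [Fin.consEquiv_apply, List.ofFn_succ, Fin.cons_zero, Fin.cons_succ, List.prod_cons,
      List.map_cons, List.reverse_cons, List.prod_append, List.prod_nil,
      mul_one, mul_assoc]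

section Det

variable {K A R : Type*} [Field K] [Ring A] [Algebra K A] [Ring R] [Algebra K R] {n : ℕ}

theorem map_oddDet (f : A →ₐ[K] R) (q : K) (X : Matrix (Fin n) (Fin n) A) :
    f (oddDet q X) = oddDet q (X.map f) := by
  simp only [oddDet, map_sum, map_smul, map_list_prod, List.map_ofFn]
  rfl

theorem evenDet_eq_oddDet_transpose (q : K) (X : Matrix (Fin n) (Fin n) A) :
    evenDet q X = oddDet q X.transpose := rfl

/-- The odd quantum determinant is the coefficient by which a linear substitution of Grassmann
variables multiplies the top word. -/
theorem IsGrassmann.prod_sum_eq_oddDet {q : K} (hq : q ≠ 0) {ψ : Fin n → R}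
    (h : IsGrassmann (-q)⁻¹ ψ) (X : Matrix (Fin n) (Fin n) R)
    (hc : ∀ i j k, Commute (X i j) (ψ k)) :
    ((List.finRange n).map fun i => ∑ j, X i j * ψ j).prod =
      oddDet q X * ((List.finRange n).map ψ).prod := by
  rw [← List.ofFn_eq_map, prod_ofFn_sum _ _ hc,
    h.sum_words (inv_ne_zero (neg_ne_zero.2 hq)) fun v => (List.ofFn fun i => X i (v i)).prod]
  rfl

/-- If `Y` preserves the relations of Grassmann variables that commute with the coefficients, and
`S * Y = 1`, then the quantum determinants of `S` and `Y`, for inverse parameters, multiply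
to `1`. No relations between the entries of `S` are needed: the reversed top word in the original
variables is expanded in the new ones. -/
theorem oddDet_inv_mul_oddDet {q : K} (hq : q ≠ 0) (f : A →ₐ[K] R) {ψ : Fin n → R}
    (hc : ∀ a k, Commute (f a) (ψ k))
    (hf : ∀ a, f a * ((List.finRange n).map ψ).prod = 0 → a = 0)
    (h : IsGrassmann (-q)⁻¹ ψ) {S Y : Matrix (Fin n) (Fin n) A} (hSY : S * Y = 1)
    (h' : IsGrassmann (-q)⁻¹ fun i => ∑ j, f (Y i j) * ψ j) :
    oddDet q⁻¹ S * oddDet q Y = 1 := by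
  set ψ' : Fin n → R := fun i => ∑ j, f (Y i j) * ψ j with hψ'
  have hκ : (-q)⁻¹ ≠ 0 := inv_ne_zero (neg_ne_zero.2 hq)
  have htop : ((List.finRange n).map ψ').prod =
      f (oddDet q Y) * ((List.finRange n).map ψ).prod := by
    rw [map_oddDet]
    exact h.prod_sum_eq_oddDet hq (Y.map f) fun i j k => hc _ _
  have hψ : ∀ i, ψ i = ∑ j, f (S i j) * ψ' j := by
    intro i
    simp only [hψ', Finset.mul_sum, ← mul_assoc, ← map_mul]
    rw [Finset.sum_comm]
    simp only [← Finset.sum_mul, ← map_sum, ← Matrix.mul_apply, hSY]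
    simp [Matrix.one_apply, apply_ite f, ite_mul]
  have hrev : ((List.finRange n).map ψ).reverse.prod =
      f (oddDet q⁻¹ S) * ((List.finRange n).map ψ').reverse.prod := by
    rw [← List.ofFn_eq_map, prod_reverse_eq_sum (fun i j => f (S i j)) ψ ψ' hψ
      (fun i j k => hc _ _), h'.sum_words_reverse hκ
        fun v => (List.ofFn fun i => f (S i (v i))).prod, map_oddDet]
    simp only [oddDet, inv_inv, inv_neg, Matrix.map_apply]
  have hp : (List.finRange n).reverse.Perm (List.finRange n) := List.reverse_perm _
  rw [← List.map_reverse, ← List.map_reverse, h.prod_of_perm _ hp, h'.prod_of_perm _ hp, htop,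
    mul_smul_comm, ← mul_assoc, ← map_mul] at hrev
  have hu := smul_right_injective R (pow_ne_zero (wordInv (List.finRange n).reverse) hκ) hrev
  refine (sub_eq_zero.1 (hf _ ?_)).symm
  rw [map_sub, map_one, sub_mul, one_mul, ← hu, sub_self]

end Det

/-! ### A faithful model of the Grassmann algebra -/

section Model

variable {K A : Type*} [Field K] [Ring A] [Algebra K A] {n : ℕ}

/-- The operator of left multiplication by the `i`-th generator on the quantum Grassmann algebra
with coefficients in `A`, in the basis of ordered monomials indexed by the subsets of `Fin n`.
The factor `κ` is collected for each generator that has to be passed. -/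
def grassmannGen (A : Type*) [Ring A] [Algebra K A] (κ : K) (i : Fin n) :
    Module.End K (Finset (Fin n) → A) where
  toFun F I := if i ∈ I then κ ^ (I.filter (· < i)).card • F (I.erase i) else 0
  map_add' F G := by
    ext I
    by_cases h : i ∈ I <;> simp [h]
  map_smul' c F := by
    ext I
    by_cases h : i ∈ I <;> simp [h, smul_comm c]

theorem grassmannGen_apply (κ : K) (i : Fin n) (F : Finset (Fin n) → A) (I : Finset (Fin n)) :
    grassmannGen A κ i F I =
      if i ∈ I then κ ^ (I.filter (· < i)).card • F (I.erase i) else 0 := rfl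

theorem isGrassmann_grassmannGen (κ : K) : IsGrassmann κ (grassmannGen (n := n) A κ) where
  sq i := by
    ext F I
    simp [Module.End.mul_apply, grassmannGen_apply]
  swap i j hij := by
    refine LinearMap.ext fun F => funext fun I => ?_
    simp only [Module.End.mul_apply, LinearMap.smul_apply, Pi.smul_apply, grassmannGen_apply,
      Finset.mem_erase, ne_eq, hij.ne, hij.ne', not_false_eq_true, true_and]
    by_cases hi : i ∈ I
    · by_cases hj : j ∈ I
      · have h1 : (I.erase j).filter (· < i) = I.filter (· < i) := by
          ext x
          simp only [Finset.mem_filter, Finset.mem_erase]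
          constructor
          · rintro ⟨⟨_, h⟩, h'⟩
            exact ⟨h, h'⟩
          · rintro ⟨h, h'⟩
            exact ⟨⟨(h'.trans hij).ne, h⟩, h'⟩
        have h2 : (I.filter (· < j)).card = ((I.erase i).filter (· < j)).card + 1 := by
          rw [Finset.filter_erase, Finset.card_erase_add_one]
          simp [hi, hij]
        rw [if_pos hi, if_pos hj, if_pos hi, if_pos hj, h1, h2, Finset.erase_right_comm]
        simp only [smul_smul]
        congr 1
        ring
      · simp [hj]
    · simp [hi]

/-- Left multiplication by the coefficients on the quantum Grassmann algebra. -/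
abbrev coeffHom (K A : Type*) [Field K] [Ring A] [Algebra K A] (n : ℕ) :
    A →ₐ[K] Module.End K (Finset (Fin n) → A) :=
  Algebra.lsmul K K (Finset (Fin n) → A)

theorem commute_coeffHom_grassmannGen (κ : K) (a : A) (i : Fin n) :
    Commute (coeffHom K A n a) (grassmannGen A κ i) := by
  refine LinearMap.ext fun F => funext fun I => ?_
  by_cases h : i ∈ I <;> simp [Module.End.mul_apply, grassmannGen_apply, h]

/-- An ordered word of generators maps the unit to the corresponding basis monomial. -/
theorem prod_grassmannGen_apply (κ : K) (L : List (Fin n)) (hL : L.Pairwise (· < ·)) :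
    ((L.map (grassmannGen A κ)).prod (Pi.single ∅ 1)) = Pi.single L.toFinset 1 := by
  induction L with
  | nil => simp
  | cons a L ih =>
    rw [List.pairwise_cons] at hL
    have ha : a ∉ L := fun h => lt_irrefl _ (hL.1 a h)
    rw [List.map_cons, List.prod_cons, Module.End.mul_apply, ih hL.2]
    ext I
    rw [grassmannGen_apply, List.toFinset_cons]
    by_cases hI : I = insert a L.toFinset
    · subst hI
      have h0 : (insert a L.toFinset).filter (· < a) = ∅ := by
        ext x
        simp only [Finset.mem_filter, Finset.mem_insert, List.mem_toFinset, Finset.notMem_empty,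
          iff_false, not_and, not_lt]
        rintro (rfl | h)
        exacts [le_rfl, (hL.1 x h).le]
      rw [h0]
      simp [ha]
    · rw [Pi.single_eq_of_ne hI]
      by_cases haI : a ∈ I
      · rw [if_pos haI, Pi.single_eq_of_ne, smul_zero]
        intro h
        exact hI (by rw [← h, Finset.insert_erase haI])
      · rw [if_neg haI]

theorem eq_zero_of_coeffHom_mul_top (κ : K) (a : A)
    (h : coeffHom K A n a *
      ((List.finRange n).map (grassmannGen A κ)).prod = 0) : a = 0 := by
  have := congrFun (LinearMap.congr_fun h (Pi.single ∅ 1)) Finset.univ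
  rw [Module.End.mul_apply, prod_grassmannGen_apply _ _ (List.pairwise_lt_finRange n)] at this
  simpa [List.toFinset_finRange] using this

end Model

/-! ### Quadratic relations preserved by super Manin matrices -/

theorem eps_of_lt {m n : ℕ} {i j : Idx m n} (h : position i < position j) : eps i j = -1 := by
  rw [eps, Int.sign_eq_neg_one_of_neg (by omega)]

theorem eps_of_gt {m n : ℕ} {i j : Idx m n} (h : position i < position j) : eps j i = 1 := by
  rw [eps, Int.sign_eq_one_of_pos (by omega)]

theorem position_injective {m n : ℕ} : Function.Injective (position : Idx m n → ℤ) := by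
  rintro (i | i) (j | j) h <;> simp only [position, Sum.elim_inl, Sum.elim_inr] at h
  · exact congrArg _ (Fin.ext (by omega))
  · omega
  · omega
  · exact congrArg _ (Fin.ext (by omega))

theorem sum_sum_eq_zero_of_antisymm {ι G : Type*} [Fintype ι] [AddCommGroup G]
    (F : ι → ι → G) (pos : ι → ℤ) (hpos : Function.Injective pos)
    (hd : ∀ j, F j j = 0) (hlt : ∀ j l, pos j < pos l → F j l + F l j = 0) :
    ∑ j, ∑ l, F j l = 0 := by
  rw [← Fintype.sum_prod_type']
  have hne : ∀ j l, j ≠ l → F j l + F l j = 0 := by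
    intro j l hjl
    rcases lt_trichotomy (pos j) (pos l) with h | h | h
    · exact hlt j l h
    · exact absurd (hpos h) hjl
    · rw [add_comm]
      exact hlt l j h
  refine Finset.sum_involution (fun p _ => (p.2, p.1)) ?_ ?_ (fun _ _ => Finset.mem_univ _)
    (fun _ _ => rfl)
  · rintro ⟨j, l⟩ _
    by_cases h : j = l
    · subst h
      simp [hd]
    · exact hne j l h
  · rintro ⟨j, l⟩ _ h h'
    simp only [Prod.mk.injEq] at h'
    obtain ⟨rfl, -⟩ := h'
    exact h (hd _)

section Quadratic

variable {K R : Type*} [Field K] [Ring R] [Algebra K R] {m n : ℕ}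

/-- The relations satisfied by the products `P j l = z j * z l` of the generators of the quantum
symmetric superalgebra, in which the even variables commute and the odd ones anticommute up to
powers of `q`. -/
structure IsSuperQuad (q : K) (P : Idx m n → Idx m n → R) : Prop where
  diag : ∀ j, parity j = 1 → P j j = 0
  swap : ∀ j l, position j < position l → P l j = ((-1) ^ (parity j * parity l) * q) • P j l

/-- The products `(∑ j, M i j z j) * (∑ l, M k l z l)` after replacing each `z j * z l` by
`P j l`; moving `z j` past `M k l` yields a sign. -/
def rowForm (K : Type*) [Field K] [Algebra K R] (M : Matrix (Idx m n) (Idx m n) R)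
    (P : Idx m n → Idx m n → R) (i k : Idx m n) : R :=
  ∑ j, ∑ l, (-1 : K) ^ (parity j * (parity k + parity l)) • (M i j * M k l * P j l)

/-- The rows of a super Manin matrix preserve the quadratic relations of the quantum symmetric
superalgebra. -/
theorem IsSuperManin.isSuperQuad_rowForm {q : K} (hq : q ≠ 0)
    {M : Matrix (Idx m n) (Idx m n) R} (hM : IsSuperManin q M) {P : Idx m n → Idx m n → R}
    (hP : IsSuperQuad q P) : IsSuperQuad q (rowForm K M P) where
  diag i hi := by
    refine sum_sum_eq_zero_of_antisymm _ position position_injective ?_ ?_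
    · intro j
      rcases j with j | j
      · rw [hM.sq_zero i _ hi rfl, zero_mul, smul_zero]
      · rw [hP.diag _ rfl, mul_zero, smul_zero]
    · intro j l hjl
      have h := sub_eq_zero.1 (hM.row i j l hi)
      rw [hP.swap j l hjl, h, eps_of_gt hjl, hi]
      rcases j with j | j <;> rcases l with l | l <;>
        norm_num [parity]
  swap i k hik := by
    rw [← sub_eq_zero]
    simp only [rowForm, Finset.smul_sum, ← Finset.sum_sub_distrib]
    refine sum_sum_eq_zero_of_antisymm _ position position_injective ?_ ?_
    · intro j
      rcases j with j | j
      · have h := sub_eq_zero.1 (hM.col i k (Sum.inl j) rfl)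
        rw [h, eps_of_lt hik]
        rcases i with i | i <;> rcases k with k | k <;> simp [parity, hq]
      · simp [hP.diag (Sum.inr j) rfl]
    · intro j l hjl
      have h := hM.cross i j k l
      rw [eps_of_lt hik, eps_of_gt hjl] at h
      have h' := congrArg (· * P j l) (sub_eq_iff_eq_add.1 h)
      simp only [sub_mul, add_mul, smul_mul_assoc] at h'
      rw [hP.swap j l hjl, h']
      rcases i with i | i <;> rcases k with k | k <;>
      rcases j with j | j <;> rcases l with l | l <;>
        simp [parity] <;> match_scalars <;> field_simp <;> ring

end Quadratic

section Coaction

variable {K R : Type*} [Field K] [Ring R] [Algebra K R] {m n : ℕ}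

theorem sum_mul_sum_of_commute {ι κ : Type*} [Fintype ι] [Fintype κ] (a : ι → R) (x : ι → R)
    (b : κ → R) (y : κ → R) (hc : ∀ j k, Commute (b k) (x j)) :
    (∑ j, a j * x j) * (∑ k, b k * y k) = ∑ j, ∑ k, a j * b k * (x j * y k) := by
  rw [Finset.sum_mul_sum]
  refine Finset.sum_congr rfl fun j _ => Finset.sum_congr rfl fun k _ => ?_
  rw [mul_assoc, ← mul_assoc (x j), ← (hc j k).eq]
  simp only [mul_assoc]

/-- The odd block of a super Manin matrix acts on Grassmann variables. -/
theorem IsSuperManin.isGrassmann_odd {q : K} (hq : q ≠ 0) {N : Matrix (Idx m n) (Idx m n) R}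
    (hN : IsSuperManin q N) {ψ : Fin n → R} (hψ : IsGrassmann (-q) ψ)
    (hc : ∀ i j k, Commute (N i j) (ψ k)) :
    IsGrassmann (-q) fun i => ∑ j, N (Sum.inr i) (Sum.inr j) * ψ j := by
  -- The even variables are set to zero.
  set P : Idx m n → Idx m n → R := fun j l =>
    Sum.elim (fun _ => 0) ψ j * Sum.elim (fun _ => 0) ψ l with hPdef
  have hP : IsSuperQuad q P := by
    constructor
    · rintro (j | j) hj
      · simp [parity] at hj
      · simpa [hPdef] using hψ.sq j
    · rintro (j | j) (l | l) h
      · simp [hPdef]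
      · simp [hPdef]
      · simp [hPdef]
      · have hjl : j < l := by
          simp only [position, Sum.elim_inr] at h
          exact Fin.lt_def.2 (by omega)
        simpa [hPdef, parity] using hψ.swap j l hjl
  have hQ := hN.isSuperQuad_rowForm hq hP
  have key : ∀ i k, rowForm K N P (Sum.inr i) (Sum.inr k) =
      (∑ j, N (Sum.inr i) (Sum.inr j) * ψ j) * ∑ j, N (Sum.inr k) (Sum.inr j) * ψ j := by
    intro i k
    rw [sum_mul_sum_of_commute _ _ _ _ fun j k => hc _ _ _]
    simp [rowForm, Fintype.sum_sum_type, hPdef, parity]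
  constructor
  · intro i
    rw [← key, hQ.diag _ rfl]
  · intro i k hik
    rw [← key, ← key, hQ.swap (Sum.inr i) (Sum.inr k)
      (by simp only [position, Sum.elim_inr]; have := Fin.lt_def.1 hik; omega)]
    simp [parity]

/-- The even rows of a super Manin matrix, paired with Grassmann variables, give variables
indexed by the columns, of which the even ones anticommute and the odd ones commute up to
powers of `q`. -/
theorem IsSuperManin.sum_even_swap {q : K} (hq : q ≠ 0) {M : Matrix (Idx m n) (Idx m n) R}
    (hM : IsSuperManin q M) {ψ : Fin m → R} (hψ : IsGrassmann (-q)⁻¹ ψ)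
    (hc : ∀ i j k, Commute (M i j) (ψ k)) {j l : Idx m n} (hjl : position j < position l) :
    (∑ i, M (Sum.inl i) l * ψ i) * (∑ i, M (Sum.inl i) j * ψ i) =
      (-((-1) ^ (parity j * parity l) * q⁻¹)) •
        ((∑ i, M (Sum.inl i) j * ψ i) * (∑ i, M (Sum.inl i) l * ψ i)) := by
  rw [sum_mul_sum_of_commute _ _ _ _ fun j k => hc _ _ _,
    sum_mul_sum_of_commute _ _ _ _ fun j k => hc _ _ _, ← sub_eq_zero]
  simp only [Finset.smul_sum, ← Finset.sum_sub_distrib]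
  refine sum_sum_eq_zero_of_antisymm _ (fun i : Fin m => ((i : ℕ) : ℤ))
    (fun a b h => Fin.ext (by simpa using h)) ?_ ?_
  · intro i
    simp [hψ.sq i]
  · intro i k hik
    have hik' : i < k := Fin.lt_def.2 (by simpa using hik)
    have h := hM.cross (Sum.inl i) j (Sum.inl k) l
    rw [eps_of_lt (show position (Sum.inl i : Idx m n) < position (Sum.inl k) from hik),
      eps_of_gt hjl] at h
    have h' := congrArg (· * (ψ i * ψ k)) (sub_eq_iff_eq_add.1 h)
    simp only [sub_mul, add_mul, smul_mul_assoc] at h'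
    rw [hψ.swap i k hik']
    simp only [mul_smul_comm, h']
    rcases j with j | j <;> rcases l with l | l <;>
      simp [parity] <;> match_scalars <;> field_simp <;> ring

theorem IsSuperManin.sum_even_sq {q : K} {M : Matrix (Idx m n) (Idx m n) R}
    (hM : IsSuperManin q M) {ψ : Fin m → R} (hψ : IsGrassmann (-q)⁻¹ ψ)
    (hc : ∀ i j k, Commute (M i j) (ψ k)) (j : Fin m) :
    (∑ i, M (Sum.inl i) (Sum.inl j) * ψ i) * (∑ i, M (Sum.inl i) (Sum.inl j) * ψ i) = 0 := by
  rw [sum_mul_sum_of_commute _ _ _ _ fun j k => hc _ _ _]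
  refine sum_sum_eq_zero_of_antisymm _ (fun i : Fin m => ((i : ℕ) : ℤ))
    (fun a b h => Fin.ext (by simpa using h)) ?_ ?_
  · intro i
    rw [hψ.sq i, mul_zero]
  · intro i k hik
    have h := sub_eq_zero.1 (hM.col (Sum.inl i) (Sum.inl k) (Sum.inl j) rfl)
    rw [h, eps_of_lt (show position (Sum.inl i : Idx m n) < position (Sum.inl k) from hik),
      hψ.swap i k (Fin.lt_def.2 (by simpa using hik))]
    simp [parity]

/-- The columns of the even block of a super Manin matrix act on Grassmann variables. -/
theorem IsSuperManin.isGrassmann_even {q : K} (hq : q ≠ 0) {M : Matrix (Idx m n) (Idx m n) R}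
    (hM : IsSuperManin q M) {ψ : Fin m → R} (hψ : IsGrassmann (-q)⁻¹ ψ)
    (hc : ∀ i j k, Commute (M i j) (ψ k)) :
    IsGrassmann (-q)⁻¹ fun j => ∑ i, M (Sum.inl i) (Sum.inl j) * ψ i where
  sq := hM.sum_even_sq hψ hc
  swap j l hjl := by
    rw [hM.sum_even_swap hq hψ hc
      (show position (Sum.inl j : Idx m n) < position (Sum.inl l) by
        simp only [position, Sum.elim_inl]; have := Fin.lt_def.1 hjl; omega)]
    simp [parity, inv_neg]

/-- A quadratic relation between Grassmann variables with coefficients on the right: multiplying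
by the remaining variables isolates each coefficient. -/
theorem IsGrassmann.top_mul_coeff {κ : K} (hκ : κ ≠ 0) {ψ : Fin m → R} (h : IsGrassmann κ ψ)
    (E : Fin m → Fin m → R) (hE : ∑ s, ∑ r, ψ s * ψ r * E s r = 0) {a b : Fin m} (hab : a < b) :
    ((List.finRange m).map ψ).prod * (E a b + κ • E b a) = 0 := by
  set J := (List.finRange m).filter fun c => c ≠ a ∧ c ≠ b with hJ
  have hmem : ∀ c, c ∈ J ↔ c ≠ a ∧ c ≠ b := by simp [hJ]
  have hperm : (J ++ [a, b]).Perm (List.finRange m) := by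
    refine (List.perm_ext_iff_of_nodup ?_ (List.nodup_finRange m)).2 fun c => ?_
    · rw [List.nodup_append]
      refine ⟨(List.nodup_finRange m).filter _, by simp [hab.ne], ?_⟩
      intro c hc d hd hcd
      subst hcd
      have := (hmem c).1 hc
      simp at hd
      tauto
    · simp only [List.mem_append, hmem, List.mem_cons, List.not_mem_nil, or_false,
        List.mem_finRange, iff_true]
      tauto
  -- Left multiplication by the word `J` in all variables other than `ψ a` and `ψ b`.
  have hw : ∀ s r, (J.map ψ).prod * (ψ s * ψ r) = ((J ++ [s, r]).map ψ).prod := by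
    intro s r
    simp
  have hzero : ∀ s r, ¬ (J ++ [s, r]).Nodup → (J.map ψ).prod * (ψ s * ψ r * E s r) = 0 := by
    intro s r hn
    rw [← mul_assoc, hw, h.prod_eq_zero hκ _ hn, zero_mul]
  have hnodup : ∀ s r, (J ++ [s, r]).Nodup → s = a ∧ r = b ∨ s = b ∧ r = a := by
    intro s r hn
    rw [List.nodup_append] at hn
    obtain ⟨-, h1, h2⟩ := hn
    have hsr : s ≠ r := by simpa using h1
    have hs : s ∉ J := fun hs => h2 s hs s (by simp) rfl
    have hr : r ∉ J := fun hr => h2 r hr r (by simp) rfl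
    rw [hmem] at hs hr
    by_cases hsa : s = a <;> by_cases hra : r = a <;> by_cases hsb : s = b <;>
      by_cases hrb : r = b <;> simp_all
  have hsum := congrArg ((J.map ψ).prod * ·) hE
  simp only [Finset.mul_sum, mul_zero] at hsum
  rw [← Fintype.sum_prod_type', ← Finset.sum_subset (Finset.subset_univ {(a, b), (b, a)}),
    Finset.sum_pair (by simp [hab.ne])] at hsum
  · dsimp only at hsum
    rw [h.swap a b hab, smul_mul_assoc, mul_smul_comm, ← mul_assoc _ (ψ a * ψ b),
      ← mul_assoc _ (ψ a * ψ b), hw,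
      h.prod_of_perm _ hperm, smul_mul_assoc, smul_mul_assoc, smul_comm κ, ← smul_add,
      ← mul_smul_comm, ← mul_add] at hsum
    exact (smul_eq_zero_iff_right (pow_ne_zero _ hκ)).1 hsum
  · rintro ⟨s, r⟩ _ hsr
    apply hzero
    intro hn
    apply hsr
    rcases hnodup s r hn with ⟨rfl, rfl⟩ | ⟨rfl, rfl⟩ <;> simp

end Coaction

/-! ### The Schur complement preserves Grassmann relations -/

section Schur

variable {K A R : Type*} [Field K] [Ring A] [Algebra K A] [Ring R] [Algebra K R] {m n : ℕ}

theorem IsSuperManin.map (f : A →ₐ[K] R) {q : K} {M : Matrix (Idx m n) (Idx m n) A}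
    (hM : IsSuperManin q M) : IsSuperManin q (M.map f) where
  sq_zero i j hi hj := by
    simpa using congrArg f (hM.sq_zero i j hi hj)
  row i k l hi := by
    simpa only [map_sub, map_smul, map_mul, map_zero, Matrix.map_apply] using
      congrArg f (hM.row i k l hi)
  col i j k hk := by
    simpa only [map_sub, map_smul, map_mul, map_zero, Matrix.map_apply] using
      congrArg f (hM.col i j k hk)
  cross i j k l := by
    simpa only [map_sub, map_smul, map_mul, map_zero, Matrix.map_apply] using
      congrArg f (hM.cross i j k l)

/-- If the quantum determinant of `M₁₁` is invertible, the entries of `Z = M₁₁⁻¹ M₁₂` satisfy the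
quadratic relations that let `-Z η` behave like a family of even variables. The odd column
variables `∑ i, (M₁₂) i l ψ i` are combinations of the even ones with coefficients `Z` on the
right; their commutation relation becomes a relation of degree two in Grassmann variables. -/
theorem IsSuperManin.even_inv_mul_relation {q : K} (hq : q ≠ 0)
    {M : Matrix (Idx m n) (Idx m n) A} (hM : IsSuperManin q M)
    (hdet : IsUnit (evenDet q M.toBlocks₁₁)) {Z : Matrix (Fin m) (Fin n) A}
    (hZ : M.toBlocks₁₁ * Z = M.toBlocks₁₂) (f : A →ₐ[K] R) {ψ : Fin m → R}
    (hψ : IsGrassmann (-q)⁻¹ ψ) (hc : ∀ a k, Commute (f a) (ψ k))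
    (hf : ∀ a, f a * ((List.finRange m).map ψ).prod = 0 → a = 0)
    {s r : Fin m} (hsr : s < r) {l t : Fin n} (hlt : l < t) :
    Z s l * Z r t - q • (Z s t * Z r l) = q • (Z r l * Z s t - q • (Z r t * Z s l)) := by
  have hκ : (-q)⁻¹ ≠ 0 := inv_ne_zero (neg_ne_zero.2 hq)
  have hM' := hM.map f
  have hc' : ∀ i j k, Commute ((M.map f) i j) (ψ k) := fun i j k => hc _ k
  -- `φ` pairs the variables with the even columns, `x` with the odd ones, and `x = φ Z`.
  set φ : Fin m → R :=
    fun j => ∑ i, (M.map f) (Sum.inl i) (Sum.inl j) * ψ i with hφdef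
  set x : Fin n → R :=
    fun j => ∑ i, (M.map f) (Sum.inl i) (Sum.inr j) * ψ i with hxdef
  have hφ : IsGrassmann (-q)⁻¹ φ := hM'.isGrassmann_even hq hψ hc'
  have hxφ : ∀ c j, x c * φ j = (-q⁻¹) • (φ j * x c) := by
    intro c j
    have := hM'.sum_even_swap hq hψ hc' (j := Sum.inl j) (l := Sum.inr c)
      (by simp only [position, Sum.elim_inl, Sum.elim_inr]; omega)
    simpa [parity, hxdef, hφdef] using this
  have hxx : x t * x l = q⁻¹ • (x l * x t) := by
    have := hM'.sum_even_swap hq hψ hc' (j := Sum.inr l) (l := Sum.inr t)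
      (by simp only [position, Sum.elim_inr]; have := Fin.lt_def.1 hlt; omega)
    simpa [parity, hxdef, hφdef] using this
  have hxZ : ∀ c, x c = ∑ b, φ b * f (Z b c) := by
    intro c
    have hB : ∀ i, M (Sum.inl i) (Sum.inr c) = ∑ b, M (Sum.inl i) (Sum.inl b) * Z b c := by
      intro i
      have := congrFun (congrFun hZ i) c
      rw [Matrix.mul_apply] at this
      exact this.symm
    simp only [hxdef, hφdef, Matrix.map_apply, hB, map_sum, map_mul, Finset.sum_mul]
    rw [Finset.sum_comm]
    refine Finset.sum_congr rfl fun b _ => Finset.sum_congr rfl fun i _ => ?_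
    rw [mul_assoc, mul_assoc, (hc (Z b c) i).eq]
  have hprod : ∀ c d, x c * x d =
      (-q⁻¹) • ∑ a, ∑ b, φ a * φ b * (f (Z b c) * f (Z a d)) := by
    intro c d
    conv_lhs => rw [hxZ d]
    simp only [Finset.mul_sum, Finset.smul_sum]
    refine Finset.sum_congr rfl fun a _ => ?_
    rw [← mul_assoc, hxφ, smul_mul_assoc, hxZ c]
    simp only [Finset.mul_sum, Finset.sum_mul, Finset.smul_sum, mul_assoc]
  have hE : ∑ a, ∑ b, φ a * φ b *
      (f (Z b t) * f (Z a l) - q⁻¹ • (f (Z b l) * f (Z a t))) = 0 := by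
    simp only [mul_sub, Finset.sum_sub_distrib, mul_smul_comm, ← Finset.smul_sum]
    rw [hprod, hprod, smul_comm q⁻¹] at hxx
    exact sub_eq_zero.2
      (smul_right_injective _ (neg_ne_zero.2 (inv_ne_zero hq)) hxx)
  -- Multiplying by the remaining `φ` turns this into a multiple of the top word, whose coefficient
  -- contains the determinant of `M₁₁` as a left factor.
  have hcoef := hφ.top_mul_coeff hκ
    (fun a b => f (Z b t) * f (Z a l) - q⁻¹ • (f (Z b l) * f (Z a t))) hE hsr
  have htop : ((List.finRange m).map φ).prod =
      f (evenDet q M.toBlocks₁₁) * ((List.finRange m).map ψ).prod := by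
    rw [evenDet_eq_oddDet_transpose, map_oddDet]
    exact hψ.prod_sum_eq_oddDet hq (M.toBlocks₁₁.transpose.map f) fun i j k => hc _ _
  set e := (Z r t * Z s l - q⁻¹ • (Z r l * Z s t)) +
    (-q)⁻¹ • (Z s t * Z r l - q⁻¹ • (Z s l * Z r t)) with he
  have hfe : f (evenDet q M.toBlocks₁₁ * e) * ((List.finRange m).map ψ).prod = 0 := by
    have hce : Commute (f e) ((List.finRange m).map ψ).prod := by
      refine Commute.list_prod_right _ _ fun y hy => ?_
      obtain ⟨k, -, rfl⟩ := List.mem_map.1 hy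
      exact hc _ _
    rw [map_mul, mul_assoc, hce.eq, ← mul_assoc, ← htop, ← hcoef]
    simp only [he, map_add, map_sub, map_smul, map_mul]
  have he0 : e = 0 := hdet.mul_right_eq_zero.1 (hf _ hfe)
  have := congrArg (q ^ 2 • ·) he0
  rw [he] at this
  simp only [smul_zero] at this
  rw [← sub_eq_zero, ← this]
  match_scalars <;> field_simp

/-- The values `P j l` of the quadratic monomials `z j * z l` after eliminating the even
variables by `y = -Z η` from the right, where the odd variables `η` are Grassmann variables. -/
def elimQuad (q : K) (Z : Matrix (Fin m) (Fin n) R) (η : Fin n → R) : Idx m n → Idx m n → R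
  | Sum.inr t, Sum.inr u => η t * η u
  | Sum.inr u, Sum.inl r => ∑ t, Z r t * (η u * η t)
  | Sum.inl s, Sum.inr t => q⁻¹ • ∑ u, Z s u * (η t * η u)
  | Sum.inl s, Sum.inl r => -(q⁻¹ • ∑ t, Z r t * ∑ u, Z s u * (η t * η u))

theorem isSuperQuad_elimQuad {q : K} (hq : q ≠ 0) {Z : Matrix (Fin m) (Fin n) R}
    {η : Fin n → R} (hη : IsGrassmann (-q) η)
    (hZ : ∀ s r, s < r → ∀ l t, l < t →
      Z s l * Z r t - q • (Z s t * Z r l) = q • (Z r l * Z s t - q • (Z r t * Z s l))) :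
    IsSuperQuad q (elimQuad q Z η) where
  diag j hj := by
    rcases j with j | j
    · simp [parity] at hj
    · exact hη.sq j
  swap j l hjl := by
    rcases j with s | s <;> rcases l with r | r
    · have hsr : s < r := by
        simp only [position, Sum.elim_inl] at hjl
        exact Fin.lt_def.2 (by omega)
      simp only [elimQuad, parity, Sum.elim_inl, mul_zero, pow_zero, one_mul]
      rw [smul_neg, ← sub_eq_zero]
      simp only [Finset.mul_sum, Finset.smul_sum, ← Finset.sum_neg_distrib,
        ← Finset.sum_sub_distrib]
      refine sum_sum_eq_zero_of_antisymm _ (fun i : Fin n => ((i : ℕ) : ℤ))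
        (fun a b h => Fin.ext (by simpa using h)) ?_ ?_
      · intro t
        simp [hη.sq t]
      · intro t u htu
        have htu' : t < u := Fin.lt_def.2 (by simpa using htu)
        have h := congrArg (· * (η t * η u)) (hZ s r hsr t u htu')
        simp only [sub_mul, smul_mul_assoc, smul_sub] at h
        rw [hη.swap t u htu']
        rw [sub_eq_iff_eq_add] at h
        simp only [← mul_assoc] at h ⊢
        simp only [mul_smul_comm, ← mul_assoc, h]
        match_scalars <;> field_simp <;> ring
    · simp only [elimQuad, parity, Sum.elim_inl, Sum.elim_inr, zero_mul, pow_zero, one_mul]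
      rw [smul_smul, mul_inv_cancel₀ hq, one_smul]
    · simp only [position, Sum.elim_inl, Sum.elim_inr] at hjl
      omega
    · have hsr : s < r := by
        simp only [position, Sum.elim_inr] at hjl
        exact Fin.lt_def.2 (by omega)
      simpa [elimQuad, parity] using hη.swap s r hsr

/-- The Schur complement `S` of the even block, given through `Z = M₁₁⁻¹ M₁₂` and
`W = M₂₁ M₁₁⁻¹`, acts on Grassmann variables once `Z` satisfies the quadratic relations
of `elimQuad`. -/
theorem IsSuperManin.isGrassmann_schur {q : K} (hq : q ≠ 0) {M : Matrix (Idx m n) (Idx m n) R}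
    (hM : IsSuperManin q M) {η : Fin n → R} (hη : IsGrassmann (-q) η)
    {Z : Matrix (Fin m) (Fin n) R} {W : Matrix (Fin n) (Fin m) R} {S : Matrix (Fin n) (Fin n) R}
    (hZ : ∀ s r, s < r → ∀ l t, l < t →
      Z s l * Z r t - q • (Z s t * Z r l) = q • (Z r l * Z s t - q • (Z r t * Z s l)))
    (hAZ : ∀ p t, ∑ r, M (Sum.inl p) (Sum.inl r) * Z r t = M (Sum.inl p) (Sum.inr t))
    (hWA : ∀ i r, ∑ p, W i p * M (Sum.inl p) (Sum.inl r) = M (Sum.inr i) (Sum.inl r))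
    (hSZ : ∀ i t, S i t =
      M (Sum.inr i) (Sum.inr t) - ∑ r, M (Sum.inr i) (Sum.inl r) * Z r t)
    (hSW : ∀ i t, S i t =
      M (Sum.inr i) (Sum.inr t) - ∑ p, W i p * M (Sum.inl p) (Sum.inr t))
    (hc : ∀ i j k, Commute (S i j) (η k)) :
    IsGrassmann (-q) fun i => ∑ j, S i j * η j := by
  set P := elimQuad q Z η with hPdef
  have hQ := hM.isSuperQuad_rowForm hq (isSuperQuad_elimQuad hq hη hZ)
  rw [← hPdef] at hQ
  set Q := rowForm K M P with hQdef
  -- The partial sums over the second column index.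
  set T : Idx m n → Idx m n → R := fun k j =>
    ∑ l, (-1 : K) ^ (parity j * (parity k + parity l)) • (M k l * P j l) with hT
  have hQT : ∀ i k, Q i k = ∑ j, M i j * T k j := by
    intro i k
    simp only [hQdef, rowForm, hT, Finset.mul_sum, mul_smul_comm, mul_assoc]
  have hTodd : ∀ k u, T (Sum.inr k) (Sum.inr u) = ∑ t, S k t * (η u * η t) := by
    intro k u
    simp only [hT, Fintype.sum_sum_type, hPdef, elimQuad, parity, Sum.elim_inl, Sum.elim_inr,
      hSZ, sub_mul, Finset.sum_sub_distrib, Finset.mul_sum, Finset.sum_mul]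
    rw [Finset.sum_comm]
    simp [mul_assoc, sub_eq_neg_add]
  have hTeven : ∀ p j, T (Sum.inl p) j = 0 := by
    rintro p (s | u)
    · simp only [hT, Fintype.sum_sum_type, hPdef, elimQuad, parity, Sum.elim_inl, Sum.elim_inr,
        zero_mul, pow_zero, one_smul, ← hAZ, Finset.sum_mul, mul_neg, mul_smul_comm,
        Finset.mul_sum, Finset.smul_sum, Finset.sum_neg_distrib]
      rw [neg_add_eq_zero, Finset.sum_comm]
      refine Finset.sum_congr rfl fun t _ => ?_
      rw [Finset.sum_comm]
      simp only [mul_assoc]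
    · simp only [hT, Fintype.sum_sum_type, hPdef, elimQuad, parity, Sum.elim_inl, Sum.elim_inr,
        ← hAZ, Finset.sum_mul, Finset.mul_sum, add_zero, mul_zero, zero_add, mul_one, pow_zero,
        pow_one, one_smul, neg_smul, Finset.sum_neg_distrib, mul_assoc]
      rw [add_neg_eq_zero, Finset.sum_comm]
  -- The elimination kills products whose right factor has an even index, and the commutation
  -- relations carry this over to the left factor.
  have hQeven : ∀ p k, Q (Sum.inl p) (Sum.inr k) = 0 := by
    intro p k
    have h := hQ.swap (Sum.inl p) (Sum.inr k)
      (by simp only [position, Sum.elim_inl, Sum.elim_inr]; omega)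
    rw [hQT (Sum.inr k) (Sum.inl p)] at h
    simp only [hTeven, mul_zero, Finset.sum_const_zero, parity, Sum.elim_inl, zero_mul,
      pow_zero, one_mul] at h
    exact (smul_eq_zero_iff_right hq).1 h.symm
  have hQodd : ∀ i k, Q (Sum.inr i) (Sum.inr k) =
      (∑ j, S i j * η j) * ∑ t, S k t * η t := by
    intro i k
    -- Row operation: subtracting `W` times the even rows clears the even columns of row `i`.
    have h0 : Q (Sum.inr i) (Sum.inr k) =
        Q (Sum.inr i) (Sum.inr k) - ∑ p, W i p * Q (Sum.inl p) (Sum.inr k) := by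
      simp [hQeven]
    rw [h0, sum_mul_sum_of_commute _ _ _ _ fun j k => hc _ _ _]
    simp only [hQT, Fintype.sum_sum_type, hTodd, mul_add, Finset.sum_add_distrib]
    have h1 : ∑ p, W i p * ∑ r, M (Sum.inl p) (Sum.inl r) * T (Sum.inr k) (Sum.inl r) =
        ∑ r, M (Sum.inr i) (Sum.inl r) * T (Sum.inr k) (Sum.inl r) := by
      simp only [← hWA, Finset.mul_sum, Finset.sum_mul, mul_assoc]
      rw [Finset.sum_comm]
    have h2 : ∑ p, W i p * ∑ u, M (Sum.inl p) (Sum.inr u) * ∑ t, S k t * (η u * η t) =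
        ∑ u, (∑ p, W i p * M (Sum.inl p) (Sum.inr u)) * ∑ t, S k t * (η u * η t) := by
      simp only [Finset.mul_sum (Finset.univ : Finset (Fin n)) _ (W i _), Finset.sum_mul, mul_assoc]
      rw [Finset.sum_comm]
    rw [h1, h2, add_sub_add_left_eq_sub, ← Finset.sum_sub_distrib]
    refine Finset.sum_congr rfl fun u _ => ?_
    rw [← sub_mul, ← hSW, Finset.mul_sum]
    simp only [mul_assoc]
  constructor
  · intro i
    rw [← hQodd, hQ.diag _ rfl]
  · intro i k hik
    rw [← hQodd, ← hQodd, hQ.swap (Sum.inr i) (Sum.inr k)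
      (by simp only [position, Sum.elim_inr]; have := Fin.lt_def.1 hik; omega)]
    simp [parity]

/-! ### Block elimination -/

/-- The Schur complement of the upper left block is inverse to the lower right block of the
inverse matrix. -/
theorem schurCompl_mul_inv (M : (Matrix (Idx m n) (Idx m n) A)ˣ)
    (M₁₁ : (Matrix (Fin m) (Fin m) A)ˣ)
    (hM₁₁ : (M₁₁ : Matrix (Fin m) (Fin m) A) = (M : Matrix (Idx m n) (Idx m n) A).toBlocks₁₁) :
    schurCompl (M : Matrix (Idx m n) (Idx m n) A) M₁₁ *
        ((M⁻¹ : (Matrix (Idx m n) (Idx m n) A)ˣ) : Matrix (Idx m n) (Idx m n) A).toBlocks₂₂ = 1 ∧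
      ((M⁻¹ : (Matrix (Idx m n) (Idx m n) A)ˣ) : Matrix (Idx m n) (Idx m n) A).toBlocks₂₂ *
        schurCompl (M : Matrix (Idx m n) (Idx m n) A) M₁₁ = 1 := by
  have h1 := M.mul_inv
  have h2 := M.inv_mul
  set N := ((M⁻¹ : (Matrix (Idx m n) (Idx m n) A)ˣ) : Matrix (Idx m n) (Idx m n) A)
  rw [← Matrix.fromBlocks_toBlocks (M : Matrix (Idx m n) (Idx m n) A),
    ← Matrix.fromBlocks_toBlocks N, Matrix.fromBlocks_multiply, ← Matrix.fromBlocks_one,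
    Matrix.fromBlocks_inj] at h1 h2
  obtain ⟨-, h12, -, h22⟩ := h1
  obtain ⟨-, -, k21, k22⟩ := h2
  rw [← hM₁₁] at h12 k21
  have e1 : ((M₁₁⁻¹ : (Matrix (Fin m) (Fin m) A)ˣ) : Matrix (Fin m) (Fin m) A) *
      ((M : Matrix (Idx m n) (Idx m n) A).toBlocks₁₂ * N.toBlocks₂₂) = -N.toBlocks₁₂ := by
    rw [← neg_eq_of_add_eq_zero_right h12, Matrix.mul_neg, ← Matrix.mul_assoc, M₁₁.inv_mul,
      Matrix.one_mul]
  have e2 : N.toBlocks₂₂ * (M : Matrix (Idx m n) (Idx m n) A).toBlocks₂₁ *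
      ((M₁₁⁻¹ : (Matrix (Fin m) (Fin m) A)ˣ) : Matrix (Fin m) (Fin m) A) = -N.toBlocks₂₁ := by
    rw [← neg_eq_of_add_eq_zero_right k21, Matrix.neg_mul, Matrix.mul_assoc, M₁₁.mul_inv,
      Matrix.mul_one]
  constructor
  · rw [schurCompl, Matrix.sub_mul, Matrix.mul_assoc, Matrix.mul_assoc, e1, Matrix.mul_neg,
      sub_neg_eq_add, add_comm, h22]
  · rw [schurCompl, Matrix.mul_sub, ← Matrix.mul_assoc, ← Matrix.mul_assoc, e2, Matrix.neg_mul,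
      sub_neg_eq_add, add_comm, k22]

/-- The Schur complement of a super Manin matrix acts on Grassmann variables as soon as the
quantum determinant of the even block is invertible. -/
theorem IsSuperManin.isGrassmann_schurCompl {q : K} (hq : q ≠ 0)
    {M : Matrix (Idx m n) (Idx m n) A} (hM : IsSuperManin q M)
    (M₁₁ : (Matrix (Fin m) (Fin m) A)ˣ) (hM₁₁ : (M₁₁ : Matrix (Fin m) (Fin m) A) = M.toBlocks₁₁)
    (hdet : IsUnit (evenDet q (M₁₁ : Matrix (Fin m) (Fin m) A))) (f : A →ₐ[K] R)
    {η : Fin n → R} (hη : IsGrassmann (-q) η) (hc : ∀ a k, Commute (f a) (η k)) :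
    IsGrassmann (-q) fun i => ∑ j, f (schurCompl M M₁₁ i j) * η j := by
  set Z := ((M₁₁⁻¹ : (Matrix (Fin m) (Fin m) A)ˣ) : Matrix (Fin m) (Fin m) A) * M.toBlocks₁₂
    with hZdef
  set W := M.toBlocks₂₁ * ((M₁₁⁻¹ : (Matrix (Fin m) (Fin m) A)ˣ) : Matrix (Fin m) (Fin m) A)
    with hWdef
  have hAZ : M.toBlocks₁₁ * Z = M.toBlocks₁₂ := by
    rw [hZdef, ← hM₁₁, ← Matrix.mul_assoc, M₁₁.mul_inv, Matrix.one_mul]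
  have hWA : W * M.toBlocks₁₁ = M.toBlocks₂₁ := by
    rw [hWdef, ← hM₁₁, Matrix.mul_assoc, M₁₁.inv_mul, Matrix.mul_one]
  have hSZ : schurCompl M M₁₁ = M.toBlocks₂₂ - M.toBlocks₂₁ * Z := by
    rw [schurCompl, hZdef, Matrix.mul_assoc]
  rw [hM₁₁] at hdet
  refine (hM.map f).isGrassmann_schur hq hη (Z := Z.map f) (W := W.map f)
    (S := (schurCompl M M₁₁).map f) ?_ ?_ ?_ ?_ ?_ fun i j k => hc _ _
  · intro s r hsr l t hlt
    have := congrArg f (hM.even_inv_mul_relation hq hdet hAZ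
      (coeffHom K A m) (isGrassmann_grassmannGen _) (commute_coeffHom_grassmannGen _)
      (eq_zero_of_coeffHom_mul_top _) hsr hlt)
    simpa only [map_sub, map_smul, map_mul, Matrix.map_apply] using this
  · intro p t
    simpa [Matrix.mul_apply, Matrix.toBlocks₁₁, Matrix.toBlocks₁₂, Matrix.toBlocks₂₁,
      Matrix.toBlocks₂₂] using congrArg f (congrFun (congrFun hAZ p) t)
  · intro i r
    simpa [Matrix.mul_apply, Matrix.toBlocks₁₁, Matrix.toBlocks₁₂, Matrix.toBlocks₂₁,
      Matrix.toBlocks₂₂] using congrArg f (congrFun (congrFun hWA i) r)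
  · intro i t
    simpa [Matrix.mul_apply, Matrix.toBlocks₁₁, Matrix.toBlocks₁₂, Matrix.toBlocks₂₁,
      Matrix.toBlocks₂₂] using congrArg f (congrFun (congrFun hSZ i) t)
  · intro i t
    simpa [Matrix.mul_apply, Matrix.toBlocks₁₁, Matrix.toBlocks₁₂, Matrix.toBlocks₂₁,
      Matrix.toBlocks₂₂] using congrArg f
      (congrFun (congrFun (show schurCompl M M₁₁ = M.toBlocks₂₂ - W * M.toBlocks₁₂ from rfl) i) t)

end Schur

end QuantumSuper

theorem corollary4p7 {K A : Type*} [Field K] [Ring A] [Algebra K A] {m n : ℕ}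
    (q : K) (hq : q ≠ 0)
    (M : (Matrix (QuantumSuper.Idx m n) (QuantumSuper.Idx m n) A)ˣ)
    (hM : QuantumSuper.IsSuperManin q
      (M : Matrix (QuantumSuper.Idx m n) (QuantumSuper.Idx m n) A))
    (hMinv : QuantumSuper.IsSuperManin q⁻¹
      ((M⁻¹ : (Matrix (QuantumSuper.Idx m n) (QuantumSuper.Idx m n) A)ˣ) :
        Matrix (QuantumSuper.Idx m n) (QuantumSuper.Idx m n) A))
    (M₁₁ : (Matrix (Fin m) (Fin m) A)ˣ)
    (hM₁₁ : (M₁₁ : Matrix (Fin m) (Fin m) A) =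
      (M : Matrix (QuantumSuper.Idx m n) (QuantumSuper.Idx m n) A).toBlocks₁₁) :
    (IsUnit (QuantumSuper.evenDet q (M₁₁ : Matrix (Fin m) (Fin m) A)) →
      IsUnit (QuantumSuper.oddDet q⁻¹ (QuantumSuper.schurCompl
        (M : Matrix (QuantumSuper.Idx m n) (QuantumSuper.Idx m n) A) M₁₁))) ∧
    ∀ u : Aˣ,
      (u : A) = QuantumSuper.oddDet q⁻¹ (QuantumSuper.schurCompl
        (M : Matrix (QuantumSuper.Idx m n) (QuantumSuper.Idx m n) A) M₁₁) →
      QuantumSuper.ber q M =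
        QuantumSuper.evenDet q (M₁₁ : Matrix (Fin m) (Fin m) A) * ((u⁻¹ : Aˣ) : A) := by
  open QuantumSuper in
  set N : Matrix (Idx m n) (Idx m n) A := ((M⁻¹ : (Matrix (Idx m n) (Idx m n) A)ˣ) :
    Matrix (Idx m n) (Idx m n) A) with hN
  obtain ⟨hSY, hYS⟩ := schurCompl_mul_inv M M₁₁ hM₁₁
  rw [← hN] at hSY hYS
  -- The relations of `M⁻¹` make its lower right block act on Grassmann variables.
  have h1 : oddDet q⁻¹ (schurCompl (M : Matrix (Idx m n) (Idx m n) A) M₁₁) *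
      oddDet q N.toBlocks₂₂ = 1 := by
    refine oddDet_inv_mul_oddDet hq (coeffHom K A n) (ψ := grassmannGen A (-q)⁻¹)
      (commute_coeffHom_grassmannGen _) (eq_zero_of_coeffHom_mul_top _)
      (isGrassmann_grassmannGen _) hSY ?_
    have hg := isGrassmann_grassmannGen (n := n) (A := A) (-q)⁻¹
    rw [inv_neg] at hg ⊢
    exact (hMinv.map (coeffHom K A n)).isGrassmann_odd (inv_ne_zero hq) hg
      fun i j k => commute_coeffHom_grassmannGen (-q⁻¹) _ k
  refine ⟨fun hdet => ?_, fun u hu => ?_⟩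
  · -- The same with the roles of the two blocks exchanged and `q` inverted.
    have h2 : oddDet q N.toBlocks₂₂ *
        oddDet q⁻¹ (schurCompl (M : Matrix (Idx m n) (Idx m n) A) M₁₁) = 1 := by
      have := oddDet_inv_mul_oddDet (inv_ne_zero hq) (coeffHom K A n)
        (ψ := grassmannGen A (-q⁻¹)⁻¹) (commute_coeffHom_grassmannGen _)
        (eq_zero_of_coeffHom_mul_top _) (isGrassmann_grassmannGen _) hYS ?_
      · rwa [inv_inv] at this
      · have hg := isGrassmann_grassmannGen (n := n) (A := A) (-q⁻¹)⁻¹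
        rw [inv_neg, inv_inv] at hg ⊢
        exact hM.isGrassmann_schurCompl hq M₁₁ hM₁₁ hdet _ hg
          fun a k => commute_coeffHom_grassmannGen _ _ _
    exact ⟨⟨_, _, h1, h2⟩, rfl⟩
  · rw [← hu] at h1
    rw [ber, ← hN, ← hM₁₁, Units.inv_eq_of_mul_eq_one_right h1]
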